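/- Let $\phi \in L^{\infty}(\mathbb{R})$ be complex-valued and let $\hat\phi$ be its Poisson integral on the right half plane $\mathbb{C}^+ = \{z \in \mathbb{C} : \operatorname{Re} z > 0\}$, \[ \hat\phi(x+iy) = \frac{1}{\pi}\int_{-\infty}^{\infty} \phi(t)\, \frac{x}{x^2+(y-t)^2}\, dt \qquad (x>0,\ y\in\mathbb{R}). \] Then, for every $y \in \mathbb{R}$, the limit \[ \lim_{x \to 0^+} \hat\phi(x+iy) \] exists in $\mathbb{C}$ if and only if the limit \[ \lim_{\theta \to 0} \frac{1}{2\theta}\int_{y-\theta}^{y+\theta} \phi(t)\, dt \] exists in $\mathbb{C}$. -/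

import Mathlib

/-- The Poisson integral of `φ : ℝ → ℂ` at the point `z = x + iy` of the right half plane `x > 0`:
`(1/π) ∫ φ(t) x / (x² + (y - t)²) dt`. The integrand is integrable for `φ ∈ L^∞(ℝ)` and `x > 0`. -/
noncomputable def poissonIntegral (φ : ℝ → ℂ) (z : ℂ) : ℂ :=
  (1 / (Real.pi : ℂ)) *
    ∫ t : ℝ, φ t * ((z.re / (z.re ^ 2 + (z.im - t) ^ 2) : ℝ) : ℂ)

/-! Substituting t = y + x s turns both expressions into averages of φ near y against dilates of a
fixed kernel: (1 + s²)⁻¹/π on one side, half the indicator of [-1, 1] on the other. For fixed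
bounded ψ, y and c, the kernels f whose averages tend to c ∫ f form a linear space, stable under
dilation and under dominated limits. It suffices that each kernel generates the other in this sense,
a hands-on Wiener Tauberian argument. Write u = (1 + s²)⁻¹. From u, dilation gives (a + s²)⁻¹,
differentiation in a gives all powers of u, Weierstrass gives u k(u) for continuous k, and ramps in
u converge to the indicator of {u ≥ 1/2} = [-1, 1]. Conversely, u is a layer-cake limit of sums of
indicators of its superlevel sets, which are symmetric intervals. -/

open MeasureTheory Filter Topology

/-- `f` is an integrable kernel whose dilates average `ψ` around `y` to the value `c`. -/
def IsAveragingKernel (ψ : ℝ → ℂ) (y : ℝ) (c : ℂ) (f : ℝ → ℝ) : Prop :=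
  Integrable f ∧
    Tendsto (fun x : ℝ => ∫ s, f s • ψ (y + x * s)) (𝓝[>] 0) (𝓝 ((∫ s, f s) • c))

/-! ### Closure properties of averaging kernels -/

lemma integrable_smul_comp_affine {ψ : ℝ → ℂ} {M : ℝ} (hm : Measurable ψ)
    (hM : ∀ t, ‖ψ t‖ ≤ M) {f : ℝ → ℝ} (hf : Integrable f) (y x : ℝ) :
    Integrable fun s => f s • ψ (y + x * s) :=
  hf.smul_bdd M (hm.comp (by fun_prop : Measurable fun s => y + x * s)).aestronglyMeasurable
    (ae_of_all _ fun _ => hM _)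

namespace IsAveragingKernel

variable {ψ : ℝ → ℂ} {y M : ℝ} {c : ℂ} {f g : ℝ → ℝ}

lemma zero : IsAveragingKernel ψ y c fun _ => 0 := by
  refine ⟨integrable_zero _ _ _, ?_⟩
  simp

lemma add (hm : Measurable ψ) (hM : ∀ t, ‖ψ t‖ ≤ M) (hf : IsAveragingKernel ψ y c f)
    (hg : IsAveragingKernel ψ y c g) : IsAveragingKernel ψ y c fun s => f s + g s := by
  refine ⟨hf.1.add hg.1, ?_⟩
  rw [integral_add hf.1 hg.1, add_smul]
  refine (hf.2.add hg.2).congr fun x => ?_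
  rw [← integral_add (integrable_smul_comp_affine hm hM hf.1 y x)
    (integrable_smul_comp_affine hm hM hg.1 y x)]
  simp only [add_smul]

lemma const_mul (r : ℝ) (hf : IsAveragingKernel ψ y c f) :
    IsAveragingKernel ψ y c fun s => r * f s := by
  refine ⟨hf.1.const_mul r, ?_⟩
  rw [integral_const_mul, mul_smul]
  refine (hf.2.const_smul r).congr fun x => ?_
  rw [← integral_smul]
  simp only [mul_smul]

lemma finset_sum {ι : Type*} (hm : Measurable ψ) (hM : ∀ t, ‖ψ t‖ ≤ M) (S : Finset ι)
    {F : ι → ℝ → ℝ} (hF : ∀ i ∈ S, IsAveragingKernel ψ y c (F i)) :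
    IsAveragingKernel ψ y c fun s => ∑ i ∈ S, F i s := by
  classical
  induction S using Finset.induction_on with
  | empty => simpa using zero
  | insert i S hi ih =>
    simp only [Finset.sum_insert hi]
    exact (hF i (Finset.mem_insert_self _ _)).add hm hM
      (ih fun j hj => hF j (Finset.mem_insert_of_mem hj))

/-- Dilating the kernel by l amounts to replacing x by x / l, which still tends to 0 from the right.
-/
lemma comp_mul {l : ℝ} (hl : 0 < l) (hf : IsAveragingKernel ψ y c f) :
    IsAveragingKernel ψ y c fun s => f (l * s) := by
  refine ⟨hf.1.comp_mul_left' hl.ne', ?_⟩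
  have h0 : Tendsto (fun x : ℝ => x / l) (𝓝[>] 0) (𝓝[>] 0) := by
    refine tendsto_nhdsWithin_iff.2 ⟨?_, ?_⟩
    · have : Tendsto (fun x : ℝ => x / l) (𝓝 0) (𝓝 (0 / l)) := tendsto_id.div_const l
      rw [zero_div] at this
      exact this.mono_left nhdsWithin_le_nhds
    · filter_upwards [self_mem_nhdsWithin] with x hx
      exact div_pos hx hl
  rw [Measure.integral_comp_mul_left f l, abs_of_pos (inv_pos.2 hl), smul_assoc]
  refine ((hf.2.comp h0).const_smul l⁻¹).congr fun x => ?_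
  have h := Measure.integral_comp_mul_left (fun u => f u • ψ (y + x / l * u)) l
  rw [abs_of_pos (inv_pos.2 hl)] at h
  simp only [Function.comp_def]
  rw [← h]
  refine integral_congr_ae (ae_of_all _ fun s => ?_)
  have : x / l * (l * s) = x * s := by field_simp
  simp only [this]

/-- Averaging kernels are closed under dominated pointwise limits. -/
lemma of_tendsto (hm : Measurable ψ) (hM : ∀ t, ‖ψ t‖ ≤ M) {F : ℕ → ℝ → ℝ}
    (hF : ∀ n, IsAveragingKernel ψ y c (F n)) (hg : Integrable g)
    (hb : ∀ n s, |F n s| ≤ g s) (hlim : ∀ s, Tendsto (fun n => F n s) atTop (𝓝 (f s))) :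
    IsAveragingKernel ψ y c f := by
  have hfm : AEStronglyMeasurable f volume :=
    aestronglyMeasurable_of_tendsto_ae atTop (fun n => (hF n).1.1) (ae_of_all _ hlim)
  have hfi : Integrable f :=
    hg.mono' hfm (ae_of_all _ fun s => le_of_tendsto' (hlim s).abs fun n => hb n s)
  refine ⟨hfi, ?_⟩
  have hL1 : Tendsto (fun n => ∫ s, |F n s - f s|) atTop (𝓝 0) := by
    have := tendsto_integral_of_dominated_convergence (μ := volume)
      (F := fun n s => |F n s - f s|) (f := fun _ => 0) (fun s => 2 * g s)
      (fun n => ((hF n).1.1.sub hfm).norm) (hg.const_mul 2)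
      (fun n => ae_of_all _ fun s => ?_) (ae_of_all _ fun s => ?_)
    · simpa using this
    · rw [Real.norm_eq_abs, abs_abs]
      have h1 := hb n s
      have h2 : |f s| ≤ g s := le_of_tendsto' (hlim s).abs fun n => hb n s
      linarith [abs_sub (F n s) (f s)]
    · simpa using ((hlim s).sub_const (f s)).abs
  -- The error is at most M times the L¹ distance of the kernels, uniformly in x, so the limits in n
  -- and x interchange.
  have hunif : TendstoUniformlyOn (fun n x => ∫ s, F n s • ψ (y + x * s))
      (fun x => ∫ s, f s • ψ (y + x * s)) atTop (Set.univ : Set ℝ) := by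
    rw [Metric.tendstoUniformlyOn_iff]
    intro ε hε
    have h2 : Tendsto (fun n => (∫ s, |F n s - f s|) * M) atTop (𝓝 0) := by
      simpa using hL1.mul_const M
    filter_upwards [h2.eventually_lt_const hε] with n hn x _
    rw [dist_comm, dist_eq_norm, ← integral_sub (integrable_smul_comp_affine hm hM (hF n).1 y x)
      (integrable_smul_comp_affine hm hM hfi y x)]
    refine lt_of_le_of_lt ?_ hn
    rw [← integral_mul_const]
    refine norm_integral_le_of_norm_le (((hF n).1.sub hfi).abs.mul_const M)
      (ae_of_all _ fun s => ?_)
    rw [← sub_smul, norm_smul, Real.norm_eq_abs]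
    exact mul_le_mul_of_nonneg_left (hM _) (abs_nonneg _)
  have hint : Tendsto (fun n => (∫ s, F n s) • c) atTop (𝓝 ((∫ s, f s) • c)) := by
    refine Tendsto.smul_const ?_ c
    exact tendsto_integral_of_dominated_convergence g (fun n => (hF n).1.1) hg
      (fun n => ae_of_all _ (hb n)) (ae_of_all _ hlim)
  exact (tendstoUniformlyOn_univ.1 hunif).tendstoUniformlyOnFilter.mono_right le_top
    |>.tendsto_of_eventually_tendsto (Eventually.of_forall fun n => (hF n).2) hint

end IsAveragingKernel

/-! ### From the Poisson kernel to the indicator of `[-1, 1]` -/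

namespace IsAveragingKernel

variable {ψ : ℝ → ℂ} {y M : ℝ} {c : ℂ} {f g : ℝ → ℝ}

lemma inv_add_sq (h : IsAveragingKernel ψ y c fun s => (1 + s ^ 2)⁻¹) {a : ℝ} (ha : 0 < a) :
    IsAveragingKernel ψ y c fun s => (a + s ^ 2)⁻¹ := by
  convert (h.comp_mul (inv_pos.2 (Real.sqrt_pos.2 ha))).const_mul a⁻¹ using 2 with s
  rw [← mul_inv, mul_pow, inv_pow, Real.sq_sqrt ha.le]
  congr 1
  field_simp

lemma inv_add_sq_pow (hm : Measurable ψ) (hM : ∀ t, ‖ψ t‖ ≤ M)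
    (h : IsAveragingKernel ψ y c fun s => (1 + s ^ 2)⁻¹) (n : ℕ) :
    ∀ a : ℝ, 0 < a → IsAveragingKernel ψ y c fun s => (a + s ^ 2)⁻¹ ^ (n + 1) := by
  induction n with
  | zero => intro a ha; simpa using h.inv_add_sq ha
  | succ n ih =>
    intro a ha
    have key : IsAveragingKernel ψ y c
        fun s => ((n + 1 : ℕ) : ℝ) * (a + s ^ 2)⁻¹ ^ (n + 1 + 1) := by
      -- `F m` is minus the difference quotient in a, with step 1 / (m + 1), of the previous power.
      refine of_tendsto hm hM (g := fun s => (n + 1 : ℕ) * a⁻¹ ^ (n + 1) * (a + s ^ 2)⁻¹)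
        (F := fun m s => ((m : ℝ) + 1) *
          ((a + s ^ 2)⁻¹ ^ (n + 1) + (-1) * (a + 1 / ((m : ℝ) + 1) + s ^ 2)⁻¹ ^ (n + 1)))
        (fun m => ((ih a ha).add hm hM
          ((ih (a + 1 / ((m : ℝ) + 1)) (by positivity)).const_mul (-1))).const_mul _)
        ((h.inv_add_sq ha).1.const_mul _) ?_ ?_
      all_goals
        -- Factoring the difference of powers cancels the small step; both the domination and the
        -- limit are read off this form.
        have hquot : ∀ (m : ℕ) (s : ℝ), ((m : ℝ) + 1) *
            ((a + s ^ 2)⁻¹ ^ (n + 1) + (-1) * (a + 1 / ((m : ℝ) + 1) + s ^ 2)⁻¹ ^ (n + 1)) =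
            (a + s ^ 2)⁻¹ * (a + 1 / ((m : ℝ) + 1) + s ^ 2)⁻¹ *
              ∑ i ∈ Finset.range (n + 1), (a + s ^ 2)⁻¹ ^ i *
                (a + 1 / ((m : ℝ) + 1) + s ^ 2)⁻¹ ^ (n + 1 - 1 - i) := by
          intro m s
          have hA : 0 < a + s ^ 2 := by positivity
          have hB : 0 < a + 1 / ((m : ℝ) + 1) + s ^ 2 := by positivity
          have hpq : (a + s ^ 2)⁻¹ - (a + 1 / ((m : ℝ) + 1) + s ^ 2)⁻¹ =
              1 / ((m : ℝ) + 1) * ((a + s ^ 2)⁻¹ * (a + 1 / ((m : ℝ) + 1) + s ^ 2)⁻¹) := by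
            rw [inv_sub_inv hA.ne' hB.ne']
            rw [div_eq_mul_inv, mul_inv]
            ring
          rw [neg_one_mul, ← sub_eq_add_neg, ← geom_sum₂_mul, hpq]
          field_simp
      · intro m s
        rw [hquot]
        have hA : 0 < a + s ^ 2 := by positivity
        have hB : 0 < a + 1 / ((m : ℝ) + 1) + s ^ 2 := by positivity
        have hpa : (a + s ^ 2)⁻¹ ≤ a⁻¹ := inv_anti₀ ha (by nlinarith [sq_nonneg s])
        have hqa : (a + 1 / ((m : ℝ) + 1) + s ^ 2)⁻¹ ≤ a⁻¹ :=
          inv_anti₀ ha (by nlinarith [sq_nonneg s, show 0 < 1 / ((m : ℝ) + 1) by positivity])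
        rw [abs_of_nonneg (by positivity)]
        have hsum : ∑ i ∈ Finset.range (n + 1), (a + s ^ 2)⁻¹ ^ i *
            (a + 1 / ((m : ℝ) + 1) + s ^ 2)⁻¹ ^ (n + 1 - 1 - i) ≤ (n + 1 : ℕ) * a⁻¹ ^ n := by
          have : ∀ i ∈ Finset.range (n + 1), (a + s ^ 2)⁻¹ ^ i *
              (a + 1 / ((m : ℝ) + 1) + s ^ 2)⁻¹ ^ (n + 1 - 1 - i) ≤ a⁻¹ ^ n := by
            intro i hi
            have hi' : n = i + (n + 1 - 1 - i) := by
              have := Finset.mem_range.1 hi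
              omega
            calc _ ≤ a⁻¹ ^ i * a⁻¹ ^ (n + 1 - 1 - i) := by gcongr
              _ = a⁻¹ ^ n := by rw [← pow_add, ← hi']
          simpa using Finset.sum_le_sum this
        calc _ ≤ (a + s ^ 2)⁻¹ * a⁻¹ * ((n + 1 : ℕ) * a⁻¹ ^ n) := by gcongr
          _ = _ := by ring
      · intro s
        simp only [hquot]
        have hA : 0 < a + s ^ 2 := by positivity
        have hq : Tendsto (fun m : ℕ => (a + 1 / ((m : ℝ) + 1) + s ^ 2)⁻¹) atTop
            (𝓝 (a + s ^ 2)⁻¹) := by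
          have h0 : Tendsto (fun m : ℕ => a + 1 / ((m : ℝ) + 1) + s ^ 2) atTop
              (𝓝 (a + 0 + s ^ 2)) :=
            (tendsto_const_nhds.add tendsto_one_div_add_atTop_nhds_zero_nat).add_const _
          rw [add_zero] at h0
          exact h0.inv₀ hA.ne'
        have hsum := tendsto_finsetSum (Finset.range (n + 1)) fun i _ =>
          (hq.pow (n + 1 - 1 - i)).const_mul ((a + s ^ 2)⁻¹ ^ i)
        have := (hq.const_mul (a + s ^ 2)⁻¹).mul hsum
        convert this using 2
        have hc : ∀ i ∈ Finset.range (n + 1), (a + s ^ 2)⁻¹ ^ i *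
            (a + s ^ 2)⁻¹ ^ (n + 1 - 1 - i) = (a + s ^ 2)⁻¹ ^ n := by
          intro i hi
          rw [← pow_add]
          congr 1
          have := Finset.mem_range.1 hi
          omega
        rw [Finset.sum_congr rfl hc]
        simp only [Finset.sum_const, Finset.card_range, nsmul_eq_mul]
        ring
    convert key.const_mul ((n + 1 : ℕ) : ℝ)⁻¹ using 2 with s
    rw [inv_mul_cancel_left₀ (by positivity)]

lemma inv_mul_polynomial (hm : Measurable ψ) (hM : ∀ t, ‖ψ t‖ ≤ M)
    (h : IsAveragingKernel ψ y c fun s => (1 + s ^ 2)⁻¹) (p : Polynomial ℝ) :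
    IsAveragingKernel ψ y c fun s => (1 + s ^ 2)⁻¹ * p.eval (1 + s ^ 2)⁻¹ := by
  induction p using Polynomial.induction_on' with
  | add p q hp hq =>
    simp only [Polynomial.eval_add, mul_add]
    exact hp.add hm hM hq
  | monomial n r =>
    convert (inv_add_sq_pow hm hM h n 1 one_pos).const_mul r using 2 with s
    rw [Polynomial.eval_monomial, pow_succ]
    ring

lemma inv_one_add_sq_mem (s : ℝ) : (1 + s ^ 2)⁻¹ ∈ Set.Icc (0 : ℝ) 1 :=
  ⟨by positivity, inv_le_one_of_one_le₀ (by nlinarith [sq_nonneg s])⟩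

lemma inv_mul_continuous (hm : Measurable ψ) (hM : ∀ t, ‖ψ t‖ ≤ M)
    (h : IsAveragingKernel ψ y c fun s => (1 + s ^ 2)⁻¹) {k : ℝ → ℝ} (hk : Continuous k) :
    IsAveragingKernel ψ y c fun s => (1 + s ^ 2)⁻¹ * k (1 + s ^ 2)⁻¹ := by
  obtain ⟨C, hC⟩ := (isCompact_Icc (a := (0 : ℝ)) (b := 1)).exists_bound_of_continuousOn
    hk.continuousOn
  choose p hp using fun m : ℕ => exists_polynomial_near_of_continuousOn 0 1 k hk.continuousOn
    (1 / ((m : ℝ) + 1)) (by positivity)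
  refine of_tendsto hm hM (fun m => inv_mul_polynomial hm hM h (p m))
    (g := fun s => (C + 1) * (1 + s ^ 2)⁻¹) (h.1.const_mul _) (fun m s => ?_) fun s => ?_
  · have hu := inv_one_add_sq_mem s
    have h1 := (hp m _ hu).le
    have h2 : 1 / ((m : ℝ) + 1) ≤ 1 := by
      rw [div_le_one (by positivity)]
      linarith [(Nat.cast_nonneg m : (0 : ℝ) ≤ m)]
    have h3 := hC _ hu
    rw [Real.norm_eq_abs] at h3
    rw [abs_mul, abs_of_nonneg hu.1, mul_comm]
    refine mul_le_mul_of_nonneg_right ?_ hu.1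
    have := abs_sub_abs_le_abs_sub ((p m).eval (1 + s ^ 2)⁻¹) (k (1 + s ^ 2)⁻¹)
    linarith
  · refine Tendsto.const_mul _ ?_
    rw [tendsto_iff_dist_tendsto_zero]
    exact squeeze_zero (fun _ => dist_nonneg)
      (fun m => (hp m _ (inv_one_add_sq_mem s)).le) tendsto_one_div_add_atTop_nhds_zero_nat

lemma indicator_of_inv (hm : Measurable ψ) (hM : ∀ t, ‖ψ t‖ ≤ M)
    (h : IsAveragingKernel ψ y c fun s => (1 + s ^ 2)⁻¹) :
    IsAveragingKernel ψ y c ((Set.Icc (-1) 1).indicator fun _ => 1) := by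
  -- Ramps equal to 1 for u ≥ 1/2, that is |s| ≤ 1. Slope at least 4 makes them vanish for u ≤ 1/4,
  -- so dividing by max u (1/4) is continuous and multiplying by u recovers the ramp.
  let T : ℕ → ℝ → ℝ := fun m u => max 0 (min 1 (1 + (m + 4) * (u - 1 / 2)))
  have hT0 : ∀ m u, 0 ≤ T m u := fun m u => le_max_left _ _
  have hT1 : ∀ m u, T m u ≤ 1 := fun m u => max_le zero_le_one (min_le_left _ _)
  have hk : ∀ m, Continuous fun u => T m u / max u (1 / 4) := by
    intro m
    refine Continuous.div (by fun_prop) (by fun_prop) fun u => ?_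
    have := le_max_right u (1 / 4)
    linarith
  refine of_tendsto hm hM (fun m => inv_mul_continuous hm hM h (hk m))
    (g := fun s => 4 * (1 + s ^ 2)⁻¹) (h.1.const_mul _) (fun m s => ?_) fun s => ?_
  · have hu := (inv_one_add_sq_mem s).1
    have hmx : 1 / 4 ≤ max (1 + s ^ 2)⁻¹ (1 / 4 : ℝ) := le_max_right _ _
    have hmx0 : 0 < max (1 + s ^ 2)⁻¹ (1 / 4 : ℝ) := by linarith
    rw [abs_of_nonneg (mul_nonneg hu (div_nonneg (hT0 _ _) hmx0.le)), mul_comm]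
    refine mul_le_mul_of_nonneg_right ?_ hu
    rw [div_le_iff₀ hmx0]
    linarith [hT1 m (1 + s ^ 2)⁻¹]
  · have hpos : 0 < 1 + s ^ 2 := by positivity
    by_cases hs : s ∈ Set.Icc (-1 : ℝ) 1
    · have hu : 1 / 2 ≤ (1 + s ^ 2)⁻¹ := by
        rw [one_div]
        exact inv_anti₀ hpos (by nlinarith [hs.1, hs.2])
      rw [Set.indicator_of_mem hs]
      refine tendsto_const_nhds.congr fun m => ?_
      have h1 : T m (1 + s ^ 2)⁻¹ = 1 := by
        have : 0 ≤ ((m : ℝ) + 4) * ((1 + s ^ 2)⁻¹ - 1 / 2) :=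
          mul_nonneg (by positivity) (by linarith)
        simp only [T]
        rw [min_eq_left (by linarith), max_eq_right zero_le_one]
      rw [h1, max_eq_left (by linarith)]
      field_simp
    · have hs2 : 1 < s ^ 2 := by
        by_contra! hc
        exact hs (abs_le.1 ((sq_le_one_iff_abs_le_one s).1 hc))
      have hu : (1 + s ^ 2)⁻¹ < 1 / 2 := by
        rw [one_div]
        exact inv_strictAnti₀ two_pos (by linarith)
      rw [Set.indicator_of_notMem hs]
      obtain ⟨N, hN⟩ := exists_nat_gt (1 / (1 / 2 - (1 + s ^ 2)⁻¹))
      refine tendsto_const_nhds.congr' ?_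
      filter_upwards [eventually_ge_atTop N] with m hmN
      have hd : 0 < 1 / 2 - (1 + s ^ 2)⁻¹ := by linarith
      rw [div_lt_iff₀ hd] at hN
      have hmN' : (N : ℝ) ≤ m := by exact_mod_cast hmN
      have h1 : T m (1 + s ^ 2)⁻¹ = 0 := by
        simp only [T]
        refine max_eq_left ((min_le_right _ _).trans ?_)
        nlinarith
      rw [h1, zero_div, mul_zero]

/-! ### From the indicator of `[-1, 1]` to the Poisson kernel -/

lemma congr_ae (hf : IsAveragingKernel ψ y c f) (hfg : f =ᵐ[volume] g) :
    IsAveragingKernel ψ y c g := by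
  refine ⟨hf.1.congr hfg, ?_⟩
  rw [← integral_congr_ae hfg]
  refine hf.2.congr fun x => integral_congr_ae ?_
  filter_upwards [hfg] with s hs
  rw [hs]

lemma indicator_Icc (h : IsAveragingKernel ψ y c ((Set.Icc (-1) 1).indicator fun _ => 1))
    {l : ℝ} (hl : 0 ≤ l) :
    IsAveragingKernel ψ y c ((Set.Icc (-l) l).indicator fun _ => 1) := by
  rcases hl.eq_or_lt with rfl | hl
  -- The interval is a null point; this case arises below at the top level j + 1 = m.
  · refine zero.congr_ae ?_
    filter_upwards [Measure.ae_ne volume (0 : ℝ)] with s hs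
    simp [hs]
  convert h.comp_mul (inv_pos.2 hl) using 2 with s
  have : s ∈ Set.Icc (-l) l ↔ l⁻¹ * s ∈ Set.Icc (-1 : ℝ) 1 := by
    rw [Set.mem_Icc, Set.mem_Icc, ← abs_le, ← abs_le, abs_mul, abs_of_pos (inv_pos.2 hl),
      inv_mul_le_iff₀ hl, mul_one]
  simp only [Set.indicator, this]

end IsAveragingKernel

lemma natFloor_eq_sum_ite {v : ℝ} {m : ℕ} (hv : v ≤ m) :
    (⌊v⌋₊ : ℝ) = ∑ j ∈ Finset.range m, if ((j + 1 : ℕ) : ℝ) ≤ v then (1 : ℝ) else 0 := by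
  rw [Finset.sum_boole]
  congr 1
  have : (Finset.range m).filter (fun j => ((j + 1 : ℕ) : ℝ) ≤ v) = Finset.range ⌊v⌋₊ := by
    ext j
    have hle : ⌊v⌋₊ ≤ m := Nat.floor_le_of_le hv
    rw [Finset.mem_filter, Finset.mem_range, Finset.mem_range,
      ← Nat.le_floor_iff' (Nat.succ_ne_zero j)]
    omega
  rw [this, Finset.card_range]

lemma IsAveragingKernel.inv_of_indicator {ψ : ℝ → ℂ} {y M : ℝ} {c : ℂ} (hm : Measurable ψ)
    (hM : ∀ t, ‖ψ t‖ ≤ M)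
    (h : IsAveragingKernel ψ y c ((Set.Icc (-1) 1).indicator fun _ => 1)) :
    IsAveragingKernel ψ y c fun s => (1 + s ^ 2)⁻¹ := by
  refine of_tendsto hm hM (g := fun s => (1 + s ^ 2)⁻¹)
    (F := fun m s => (m : ℝ)⁻¹ * (⌊(1 + s ^ 2)⁻¹ * (m : ℝ)⌋₊ : ℝ)) (fun m => ?_)
    integrable_inv_one_add_sq (fun m s => ?_) fun s => ?_
  · refine const_mul _ ?_
    have hind : ∀ j ∈ Finset.range m, IsAveragingKernel ψ y c
        fun s => if ((j + 1 : ℕ) : ℝ) ≤ (1 + s ^ 2)⁻¹ * m then 1 else 0 := by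
      intro j hj
      have hjm : ((j + 1 : ℕ) : ℝ) ≤ m := by exact_mod_cast Finset.mem_range.1 hj
      have hj0 : (0 : ℝ) < ((j + 1 : ℕ) : ℝ) := by positivity
      have hq : 0 ≤ (m : ℝ) / ((j + 1 : ℕ) : ℝ) - 1 := by
        rw [sub_nonneg, one_le_div hj0]
        exact hjm
      -- The level j + 1 is reached by m u exactly when s² ≤ m / (j + 1) - 1.
      convert h.indicator_Icc (Real.sqrt_nonneg ((m : ℝ) / ((j + 1 : ℕ) : ℝ) - 1)) using 2 with s
      have hiff : s ∈ Set.Icc (-√((m : ℝ) / ((j + 1 : ℕ) : ℝ) - 1))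
          √((m : ℝ) / ((j + 1 : ℕ) : ℝ) - 1) ↔ ((j + 1 : ℕ) : ℝ) ≤ (1 + s ^ 2)⁻¹ * m := by
        rw [Set.mem_Icc, ← abs_le, ← Real.sqrt_sq_eq_abs, Real.sqrt_le_sqrt_iff hq,
          le_sub_iff_add_le, le_div_iff₀ hj0, mul_comm (1 + s ^ 2)⁻¹, ← div_eq_mul_inv,
          le_div_iff₀ (by positivity)]
        ring_nf
      simp only [Set.indicator, hiff]
    convert finset_sum hm hM (Finset.range m) hind using 2 with s
    refine natFloor_eq_sum_ite ?_
    exact mul_le_of_le_one_left (Nat.cast_nonneg m) (inv_one_add_sq_mem s).2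
  · have hu := (inv_one_add_sq_mem s).1
    rw [abs_of_nonneg (by positivity)]
    rcases m.eq_zero_or_pos with rfl | hpos
    · simpa using hu
    have hp : (0 : ℝ) < m := by exact_mod_cast hpos
    rw [inv_mul_le_iff₀ hp, mul_comm (m : ℝ)]
    exact Nat.floor_le (by positivity)
  · have := (tendsto_nat_floor_mul_div_atTop (inv_one_add_sq_mem s).1).comp
      tendsto_natCast_atTop_atTop
    refine this.congr fun m => ?_
    simp only [Function.comp_apply, div_eq_inv_mul]

/-! ### Rescaling the two averages -/

lemma integral_comp_add_mul {E : Type*} [NormedAddCommGroup E] [NormedSpace ℝ E] (F : ℝ → E)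
    (y : ℝ) {x : ℝ} (hx : 0 < x) : ∫ s, F (y + x * s) = x⁻¹ • ∫ t, F t := by
  rw [Measure.integral_comp_mul_left (fun u => F (y + u)) x, abs_of_pos (inv_pos.2 hx),
    integral_add_left_eq_self]

lemma poissonIntegral_eq_smul_integral (ψ : ℝ → ℂ) (y : ℝ) {x : ℝ} (hx : 0 < x) :
    poissonIntegral ψ ((x : ℂ) + (y : ℂ) * Complex.I) =
      Real.pi⁻¹ • ∫ s, (1 + s ^ 2)⁻¹ • ψ (y + x * s) := by
  have h := integral_comp_add_mul
    (fun t => ψ t * ((x / (x ^ 2 + (y - t) ^ 2) : ℝ) : ℂ)) y hx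
  rw [eq_inv_smul_iff₀ hx.ne', ← integral_smul] at h
  simp only [poissonIntegral, Complex.add_re, Complex.ofReal_re, Complex.re_ofReal_mul,
    Complex.I_re, mul_zero, add_zero, Complex.add_im, Complex.ofReal_im, Complex.im_ofReal_mul,
    Complex.I_im, mul_one, zero_add]
  rw [← h, Complex.real_smul, Complex.ofReal_inv, one_div]
  congr 2
  ext s
  have hk : x * (x / (x ^ 2 + (y - (y + x * s)) ^ 2)) = (1 + s ^ 2)⁻¹ := by
    field_simp
    ring
  rw [← hk, Complex.real_smul, Complex.real_smul]
  push_cast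
  ring

lemma average_eq_smul_integral (ψ : ℝ → ℂ) (y : ℝ) {x : ℝ} (hx : 0 < x) :
    (1 / (2 * (x : ℂ))) * ∫ t in (y - x)..(y + x), ψ t =
      (2 : ℝ)⁻¹ • ∫ s, (Set.Icc (-1 : ℝ) 1).indicator (fun _ => (1 : ℝ)) s • ψ (y + x * s) := by
  have hI : ∫ s, (Set.Icc (-1 : ℝ) 1).indicator (fun _ => (1 : ℝ)) s • ψ (y + x * s) =
      x⁻¹ • ∫ t in (y - x)..(y + x), ψ t := by
    have h1 : ∀ s, (Set.Icc (-1 : ℝ) 1).indicator (fun _ => (1 : ℝ)) s • ψ (y + x * s) =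
        (Set.Icc (-1 : ℝ) 1).indicator (fun s => ψ (y + x * s)) s := by
      intro s
      by_cases hs : s ∈ Set.Icc (-1 : ℝ) 1 <;> simp [hs]
    simp only [h1]
    rw [integral_indicator measurableSet_Icc, integral_Icc_eq_integral_Ioc,
      ← intervalIntegral.integral_of_le (by norm_num),
      intervalIntegral.integral_comp_add_mul ψ hx.ne' y]
    ring_nf
  rw [hI, Complex.real_smul, Complex.real_smul]
  push_cast
  field_simp

/-- The symmetric average is even in θ. -/
lemma tendsto_average_nhdsNE_iff (φ : ℝ → ℂ) (y : ℝ) (b : ℂ) :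
    Tendsto (fun θ : ℝ => (1 / (2 * (θ : ℂ))) * ∫ t in (y - θ)..(y + θ), φ t) (𝓝[≠] 0) (𝓝 b) ↔
      Tendsto (fun θ : ℝ => (1 / (2 * (θ : ℂ))) * ∫ t in (y - θ)..(y + θ), φ t)
        (𝓝[>] 0) (𝓝 b) := by
  refine ⟨fun h => h.mono_left (nhdsWithin_mono _ fun x hx => ne_of_gt hx), fun h => ?_⟩
  rw [← Set.Iio_union_Ioi, nhdsWithin_union, tendsto_sup]
  refine ⟨?_, h⟩
  have hneg : Tendsto (fun θ : ℝ => -θ) (𝓝[<] 0) (𝓝[>] 0) := by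
    simpa using tendsto_neg_nhdsLT (a := (0 : ℝ))
  refine (h.comp hneg).congr fun θ => ?_
  simp only [Function.comp_apply, sub_neg_eq_add, ← sub_eq_add_neg]
  rw [intervalIntegral.integral_symm (y - θ) (y + θ)]
  push_cast
  rw [mul_neg, mul_neg, one_div_neg_eq_neg_one_div, neg_mul, neg_neg]

/-- If the dilates of a kernel of positive mass have a limiting average, the kernel is averaging
for the normalised limit. -/
lemma isAveragingKernel_iff {ψ : ℝ → ℂ} {y : ℝ} {c : ℂ} {f : ℝ → ℝ} {r : ℝ} (hf : Integrable f)
    (hr : ∫ s, f s = r) (hr0 : r ≠ 0) {G : ℝ → ℂ}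
    (hG : ∀ x : ℝ, 0 < x → G x = r⁻¹ • ∫ s, f s • ψ (y + x * s)) :
    IsAveragingKernel ψ y c f ↔ Tendsto G (𝓝[>] 0) (𝓝 c) := by
  have hev : G =ᶠ[𝓝[>] 0] fun x => r⁻¹ • ∫ s, f s • ψ (y + x * s) := by
    filter_upwards [self_mem_nhdsWithin] with x hx using hG x hx
  rw [tendsto_congr' hev, IsAveragingKernel, hr]
  refine ⟨fun h => ?_, fun h => ⟨hf, ?_⟩⟩
  · simpa only [smul_smul, inv_mul_cancel₀ hr0, one_smul] using h.2.const_smul r⁻¹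
  · simpa only [smul_smul, mul_inv_cancel₀ hr0, one_smul] using h.const_smul r

/-- Truncating a measurable representative makes the bound hold everywhere; both averages only see
the a.e. class. -/
lemma exists_measurable_bounded_ae_eq {φ : ℝ → ℂ} (hφ : MemLp φ ⊤ volume) :
    ∃ (ψ : ℝ → ℂ) (M : ℝ), Measurable ψ ∧ (∀ t, ‖ψ t‖ ≤ M) ∧ φ =ᵐ[volume] ψ := by
  let u := hφ.1.mk φ
  have hu : Measurable u := hφ.1.stronglyMeasurable_mk.measurable
  let M := lpNorm φ ⊤ volume
  have hM : ∀ᵐ t, ‖φ t‖ ≤ M := ae_le_lpNorm_exponent_top hφ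
  refine ⟨{t | ‖u t‖ ≤ M}.indicator u, M,
    hu.indicator (measurableSet_le hu.norm measurable_const), fun t => ?_, ?_⟩
  · by_cases ht : ‖u t‖ ≤ M
    · rwa [Set.indicator_of_mem (by exact ht)]
    · rw [Set.indicator_of_notMem (by exact ht), norm_zero]
      exact lpNorm_nonneg
  · filter_upwards [hφ.1.ae_eq_mk, hM] with t h1 h2
    rw [h1] at h2
    rw [Set.indicator_of_mem (by exact h2)]
    exact h1

theorem theorem4p7 (φ : ℝ → ℂ) (hφ : MeasureTheory.MemLp φ ⊤ MeasureTheory.volume) (y : ℝ) :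
    (∃ a : ℂ, Filter.Tendsto
        (fun x : ℝ => poissonIntegral φ ((x : ℂ) + (y : ℂ) * Complex.I))
        (nhdsWithin 0 (Set.Ioi 0)) (nhds a)) ↔
      (∃ b : ℂ, Filter.Tendsto
        (fun θ : ℝ => (1 / (2 * (θ : ℂ))) * ∫ t in (y - θ)..(y + θ), φ t)
        (nhdsWithin 0 {0}ᶜ) (nhds b)) := by
  obtain ⟨ψ, M, hm, hM, hφψ⟩ := exists_measurable_bounded_ae_eq hφ
  -- The two limits coincide, so the equivalence is proved for each fixed value.
  refine exists_congr fun c => ?_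
  rw [tendsto_average_nhdsNE_iff]
  have hP : ∀ x : ℝ, 0 < x → poissonIntegral φ ((x : ℂ) + (y : ℂ) * Complex.I) =
      Real.pi⁻¹ • ∫ s, (1 + s ^ 2)⁻¹ • ψ (y + x * s) := by
    intro x hx
    rw [← poissonIntegral_eq_smul_integral ψ y hx, poissonIntegral, poissonIntegral]
    congr 1
    refine integral_congr_ae ?_
    filter_upwards [hφψ] with t ht
    rw [ht]
  have hA : ∀ x : ℝ, 0 < x → (1 / (2 * (x : ℂ))) * ∫ t in (y - x)..(y + x), φ t =
      (2 : ℝ)⁻¹ •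
        ∫ s, (Set.Icc (-1 : ℝ) 1).indicator (fun _ => (1 : ℝ)) s • ψ (y + x * s) := by
    intro x hx
    rw [← average_eq_smul_integral ψ y hx]
    congr 1
    refine intervalIntegral.integral_congr_ae ?_
    filter_upwards [hφψ] with t ht _ using ht
  have hint : Integrable ((Set.Icc (-1 : ℝ) 1).indicator fun _ => (1 : ℝ)) :=
    (integrable_indicator_iff measurableSet_Icc).2
      (integrableOn_const measure_Icc_lt_top.ne)
  have hmass : ∫ s, (Set.Icc (-1 : ℝ) 1).indicator (fun _ => (1 : ℝ)) s = 2 := by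
    rw [integral_indicator measurableSet_Icc]
    norm_num
  rw [← isAveragingKernel_iff integrable_inv_one_add_sq integral_univ_inv_one_add_sq
    Real.pi_ne_zero hP, ← isAveragingKernel_iff hint hmass two_ne_zero hA]
  exact ⟨fun h => h.indicator_of_inv hm hM, fun h => h.inv_of_indicator hm hM⟩
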